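/- Conventions. A Borel graph is a graph $\mathcal G=(V,E)$ (no loops, symmetric edges) whose vertex set $V$ is a standard Borel space and whose edge set $E$ is a Borel subset of $V\times V$; it is locally finite if every vertex has finitely many neighbours. For $t\in\omega$, a $t$-local rule on labelled graphs is a function of a vertex $x$ whose value depends only on the isomorphism type of the labelled subgraph induced by the ball of radius $t$ around $x$ and rooted at $x$ (isomorphisms preserve the labels and the root). An LCL is a $\{0,1\}$-valued $t$-local rule, for some $t\in\omega$, on graphs with $\omega^2$-valued labellings. For an LCL $\mathbf P$, a labelling $\ell:V\to\omega$ and an assignment $a:V\to\omega$, let $\mathbf P(a)\subseteq V$ be the set of vertices at which $\mathbf P$ outputs $1$ on $\mathcal G$ labelled by $x\mapsto(\ell(x),a(x))$; $a$ solves $\mathbf P$ on $(\mathcal G,\ell)$ if $\mathbf P(a)=V$. For LCLs $\mathbf C,\mathbf P$ and $r\in\omega$, an $r$-augmentation of an assignment $a$ solving $\mathbf C$ (with respect to $\mathbf P$) is an assignment $a'$ obtained from $a$ by changing its values on a set $R\subseteq V$ with $|R|\le r$ and with the induced subgraph $\mathcal G[R]$ connected, such that $a'$ solves $\mathbf C$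 and $\mathbf P(a)\subsetneq\mathbf P(a')$. Theorem. Let $\mathbf C$ and $\mathbf P$ be LCLs. Let $\mathcal G$ be a locally finite Borel graph with a Borel labelling $\ell:V\to\omega$ and a Borel assignment $a_0:V\to\omega$ that solves $\mathbf C$ on $(\mathcal G,\ell)$. Then for every integer $r\ge 1$ there is a Borel assignment $a:V\to\omega$ such that $a$ solves $\mathbf C$ on $(\mathcal G,\ell)$ and admits no $r$-augmentation with respect to $\mathbf P$. Additionally, for this $a$, the set $\mathbf P(a)\setminus\mathbf P(a_0)$ is Borel and there are $r$ Borel maps $$f_j:\mathbf P(a)\setminus\mathbf P(a_0)\to V,\qquad 0\le j<r,$$ such that, for every $j$ and every $y$ in the domain, $f_j(y)$ lies in the same connected component of $\mathcal G$ as $y$, and every $x\in V$ with $a(x)\ne a_0(x)$ is in the image of at least one $f_j$. -/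

import Mathlib

universe u v w

namespace BorelLCL

/-- A rooted graph `(G, root)` together with a vertex labelling with values in `Λ`. -/
structure RootedLabelledGraph (Λ : Type v) : Type (max (u + 1) v) where
  /-- the vertex set -/
  Vert : Type u
  /-- the graph -/
  graph : SimpleGraph Vert
  /-- the vertex labelling -/
  label : Vert → Λ
  /-- the root -/
  root : Vert

namespace RootedLabelledGraph

/-- Two rooted labelled graphs are isomorphic if there is a graph isomorphism between them that
preserves the labels and the root. -/
def Isomorphic {Λ : Type v} (A B : RootedLabelledGraph.{u, v} Λ) : Prop :=
  ∃ φ : A.graph ≃g B.graph, (∀ y, B.label (φ y) = A.label y) ∧ φ A.root = B.root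

/-- The equivalence relation of being isomorphic. -/
def isoSetoid (Λ : Type v) : Setoid (RootedLabelledGraph.{u, v} Λ) where
  r := Isomorphic
  iseqv :=
    { refl := fun A => ⟨SimpleGraph.Iso.refl, fun _ => rfl, rfl⟩
      symm := by
        rintro A B ⟨φ, hl, hr⟩
        refine ⟨φ.symm, fun y => ?_, ?_⟩
        · rw [← hl (φ.symm y), φ.apply_symm_apply]
        · rw [← hr, φ.symm_apply_apply]
      trans := by
        rintro A B C ⟨φ, hl, hr⟩ ⟨ψ, hl', hr'⟩
        refine ⟨φ.trans ψ, fun y => ?_, ?_⟩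
        · exact (hl' (φ y)).trans (hl y)
        · exact (congrArg ψ hr).trans hr' }

end RootedLabelledGraph

/-- Isomorphism types of rooted `Λ`-labelled graphs. -/
def IsoType (Λ : Type v) : Type (max (u + 1) v) :=
  Quotient (RootedLabelledGraph.isoSetoid.{u, v} Λ)

/-- The `r`-ball around `x`: the vertices at graph distance at most `r` from `x`
(the extended distance is infinite between different components). -/
def ball {V : Type u} (G : SimpleGraph V) (r : ℕ) (x : V) : Set V :=
  {y | G.edist x y ≤ (r : ℕ∞)}

/-- The root belongs to its ball. -/
theorem mem_ball_self {V : Type u} (G : SimpleGraph V) (r : ℕ) (x : V) : x ∈ ball G r x := by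
  simp [ball]

/-- The labelled graph induced by the `r`-ball around `x`, rooted at `x`. -/
def rootedBall {V : Type u} {Λ : Type v} (G : SimpleGraph V) (c : V → Λ) (r : ℕ) (x : V) :
    RootedLabelledGraph.{u, v} Λ where
  Vert := ball G r x
  graph := G.induce (ball G r x)
  label := fun y => c y
  root := ⟨x, mem_ball_self G r x⟩

/-- The function sending a vertex `x` to the isomorphism type of its rooted labelled `r`-ball. -/
def ballType {V : Type u} {Λ : Type v} (G : SimpleGraph V) (c : V → Λ) (r : ℕ) (x : V) :
    IsoType.{u, v} Λ :=
  Quotient.mk (RootedLabelledGraph.isoSetoid.{u, v} Λ) (rootedBall G c r x)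

/-- A local rule on `Λ`-labelled graphs: a radius `r` together with a function of the isomorphism
type of the rooted labelled `r`-ball. -/
structure LocalRule (Λ : Type v) (β : Type w) : Type (max (u + 1) v w) where
  /-- the radius of the rule -/
  radius : ℕ
  /-- the output, as a function of the isomorphism type of the ball of that radius -/
  out : IsoType.{u, v} Λ → β

/-- The function on vertices computed by a local rule on the labelled graph `(G, c)`. -/
def LocalRule.eval {V : Type u} {Λ : Type v} {β : Type w} (R : LocalRule.{u, v, w} Λ β)
    (G : SimpleGraph V) (c : V → Λ) (x : V) : β :=
  R.out (ballType G c R.radius x)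

/-- A locally checkable labelling problem: a two-valued local rule on `ℕ × ℕ`-labelled graphs. -/
abbrev LCL : Type (u + 1) := LocalRule.{u, 0, 0} (ℕ × ℕ) Bool

/-- The set of vertices of `(G, ℓ)` at which the assignment `a` satisfies the LCL `P`, that is,
those at which `P` outputs `1` on `(G, (ℓ, a))`. -/
def LCL.satSet {V : Type u} (P : LCL.{u}) (G : SimpleGraph V) (ℓ a : V → ℕ) : Set V :=
  {x | P.eval G (fun y => (ℓ y, a y)) x = true}

/-- The assignment `a` solves the LCL `C` on `(G, ℓ)`. -/
def LCL.Solves {V : Type u} (C : LCL.{u}) (G : SimpleGraph V) (ℓ a : V → ℕ) : Prop :=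
  LCL.satSet C G ℓ a = Set.univ

open Classical in
/-- The assignment obtained from `a` by superseding its values on `R` by those of `b`. -/
noncomputable def replace {V : Type u} (a : V → ℕ) (R : Set V) (b : R → ℕ) : V → ℕ :=
  fun x => if h : x ∈ R then b ⟨x, h⟩ else a x

/-- `a'` is an `r`-augmentation of `a` (with constraints `C` and progress measured by `P`): it is
obtained from `a` by changing the values on a connected set of at most `r` vertices, it solves `C`,
and its progress set is strictly larger than that of `a`. -/
def IsAugmentation {V : Type u} (C P : LCL.{u}) (G : SimpleGraph V) (ℓ : V → ℕ) (r : ℕ)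
    (a a' : V → ℕ) : Prop :=
  ∃ (R : Set V) (b : R → ℕ), (G.induce R).Preconnected ∧ R.encard ≤ (r : ℕ∞) ∧
    a' = replace a R b ∧ LCL.Solves C G ℓ a' ∧ LCL.satSet P G ℓ a ⊂ LCL.satSet P G ℓ a'

/-- A graph on a measurable space is Borel if its edge relation is a Borel subset of the square;
this is used when the vertex set is a standard Borel space. -/
def IsBorelGraph {V : Type u} [MeasurableSpace V] (G : SimpleGraph V) : Prop :=
  MeasurableSet {p : V × V | G.Adj p.1 p.2}

end BorelLCL

/-! Let `T` bound the radii of both rules, and let `c` be a Borel colouring with countably many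
colours that separates distinct vertices at distance at most `2r + 2T`. A connected set of at most
`r` vertices lies in the `r`-ball of each of its points, so an augmentation can be recorded by
colours alone: that of a centre, those of the changed vertices, and a new value for each colour.
There are only countably many such instructions. In a sequence where each recurs infinitely often,
step `n` carries out the `n`-th one simultaneously around all centres where it makes progress
(`augmentStep`). Equal colours are far apart, so these rewritings do not interfere: `C` stays solved
and the `P`-set grows.

A vertex enters the `P`-set at most once, and every change happens within `2r + T` of a vertex just
entering. Balls are finite, so each value changes finitely often (`eventually_augmentSeq_eq`) and
the limit `a` is Borel. An augmentation of `a` yields an instruction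
(`IsAugmentation.exists_instruction`) that is carried out once more after the values near its centre
have settled; it would then gain a vertex whose status is already final. The map `f j` sends a
gained vertex to the vertex of the `j`-th listed colour in the rewriting that gained it.

Borelness rests on `measurableSet_exists_of_finite`: projections with finite sections preserve Borel
sets, which is derived here from Novikov's separation theorem. -/

namespace BorelLCL

open Set MeasureTheory TopologicalSpace
open PiNat hiding cylinder

/-! ### Novikov separation of analytic sets -/

/-- A countable family of sets is Borel separated if it has Borel supersets with empty
intersection. -/
def NovikovSeparated {X : Type*} [MeasurableSpace X] (A : ℕ → Set X) : Prop :=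
  ∃ B : ℕ → Set X, (∀ i, A i ⊆ B i) ∧ (∀ i, MeasurableSet (B i)) ∧ ⋂ i, B i = ∅

/-- Splitting one set of a family into countably many pieces. -/
theorem NovikovSeparated.of_split {X : Type*} [MeasurableSpace X] {A : ℕ → Set X} (i : ℕ)
    {A' : ℕ → ℕ → Set X} (hi : A i ⊆ ⋃ j, A' j i) (hne : ∀ k, k ≠ i → ∀ j, A k ⊆ A' j k)
    (h : ∀ j, NovikovSeparated (A' j)) : NovikovSeparated A := by
  choose B hAB hB hemp using h
  -- A common point lies in `B j i` for some `j`, and then in `B j k` for every `k`, which is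
  -- impossible.
  refine ⟨fun k => if k = i then ⋃ j, B j k else ⋂ j, B j k, fun k => ?_, fun k => ?_, ?_⟩
  · by_cases hk : k = i
    · subst hk
      simp only [if_true]
      exact hi.trans (iUnion_mono fun j => hAB j k)
    · simp only [hk, if_false]
      exact subset_iInter fun j => (hne k hk j).trans (hAB j k)
  · by_cases hk : k = i
    · simp only [hk, if_true]
      exact MeasurableSet.iUnion fun j => hB j i
    · simp only [hk, if_false]
      exact MeasurableSet.iInter fun j => hB j k
  · refine eq_empty_of_forall_notMem fun x hx => ?_
    rw [mem_iInter] at hx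
    have h1 := hx i
    simp only [if_true, mem_iUnion] at h1
    obtain ⟨j, hj⟩ := h1
    have : x ∈ ⋂ k, B j k := by
      refine mem_iInter.2 fun k => ?_
      by_cases hk : k = i
      · rwa [hk]
      · have := hx k
        simp only [hk, if_false, mem_iInter] at this
        exact this j
    rw [hemp j] at this
    exact this

/-- A branch through a tree-like predicate on finite sequences. -/
theorem exists_branch {Q : ℕ → (ℕ → ℕ) → Prop} (h0 : ∀ z, Q 0 z)
    (hstep : ∀ n z, Q n z → ∃ j, Q (n + 1) (Function.update z n j))
    (hcongr : ∀ n z z', (∀ i < n, z i = z' i) → Q n z → Q n z') : ∃ x, ∀ n, Q n x := by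
  have hs : ∀ n z, ∃ j, Q n z → Q (n + 1) (Function.update z n j) := by
    intro n z
    by_cases h : Q n z
    · obtain ⟨j, hj⟩ := hstep n z h
      exact ⟨j, fun _ => hj⟩
    · exact ⟨0, fun h' => absurd h' h⟩
  choose F hF using hs
  let z : ℕ → ℕ → ℕ := fun n => Nat.rec (fun _ => 0) (fun n z => Function.update z n (F n z)) n
  have hz : ∀ n, z (n + 1) = Function.update (z n) n (F n (z n)) := fun n => rfl
  have hQ : ∀ n, Q n (z n) := by
    intro n
    induction n with
    | zero => exact h0 _
    | succ n ih => rw [hz]; exact hF n _ ih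
  have hx : ∀ n, ∀ i < n, z n i = z (i + 1) i := by
    intro n
    induction n with
    | zero => intro i hi; omega
    | succ n ih =>
      intro i hi
      rcases Nat.lt_succ_iff_lt_or_eq.1 hi with h | rfl
      · rw [hz, Function.update_of_ne h.ne, ih i h]
      · rfl
  exact ⟨fun m => z (m + 1) m, fun n => hcongr n (z n) _ (hx n) (hQ n)⟩

/-- If separation fails, splitting one coordinate at a time preserves the failure and produces a
branch `x` with no separation along any of its cylinders. The images of `x` cannot all coincide, so
two of them have disjoint open neighbourhoods, and these separate the images of a small cylinder. -/
theorem novikovSeparated_range {X : Type*} [TopologicalSpace X] [T2Space X] [MeasurableSpace X]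
    [OpensMeasurableSpace X] {f : ℕ → (ℕ → ℕ) → X} (hf : ∀ i, Continuous (f i))
    (h : ⋂ i, range (f i) = ∅) : NovikovSeparated fun i => range (f i) := by
  by_contra hcon
  -- A single sequence codes a point of every domain, so fixing its coordinate `n` cuts down only
  -- the image of index `n.unpair.1`.
  let g : ℕ → (ℕ → ℕ) → X := fun i z => f i fun m => z (Nat.pair i m)
  have hg : ∀ i, Continuous (g i) := fun i => (hf i).comp (by fun_prop)
  have hrange : ∀ i, range (f i) ⊆ range (g i) := by
    rintro i _ ⟨y, rfl⟩
    refine ⟨fun n => y n.unpair.2, ?_⟩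
    simp [g]
  have hbranch : ∃ x, ∀ n, ¬ NovikovSeparated fun i => g i '' PiNat.cylinder x n := by
    refine exists_branch
      (Q := fun n z => ¬ NovikovSeparated fun i => g i '' PiNat.cylinder z n) ?_ ?_ ?_
    · intro z hz
      obtain ⟨B, hAB, hB, hemp⟩ := hz
      exact hcon ⟨B, fun i => (hrange i).trans (by simpa using hAB i), hB, hemp⟩
    · intro n z hz
      by_contra! hall
      refine hz (NovikovSeparated.of_split n.unpair.1 ?_ ?_ hall)
      · rw [← image_iUnion]
        exact image_mono (iUnion_cylinder_update z n).ge
      · rintro k hk j _ ⟨y, hy, rfl⟩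
        refine ⟨Function.update y n j, fun i hi => ?_, ?_⟩
        · rcases Nat.lt_succ_iff_lt_or_eq.1 hi with h | rfl
          · rw [Function.update_of_ne h.ne, Function.update_of_ne h.ne]; exact hy i h
          · simp
        · simp only [g]
          congr 1
          funext m
          rw [Function.update_of_ne]
          rintro rfl
          simp at hk
    · intro n z z' hzz' hz
      rwa [← mem_cylinder_iff_eq.1 (show z ∈ PiNat.cylinder z' n from hzz')]
  obtain ⟨x, hx⟩ := hbranch
  have hne : ∃ i j, g i x ≠ g j x := by
    by_contra! hall
    have : g 0 x ∈ ⋂ i, range (f i) := mem_iInter.2 fun i => by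
      rw [hall 0 i]
      exact mem_range_self _
    rw [h] at this
    exact this
  obtain ⟨i, j, hij⟩ := hne
  obtain ⟨U, W, hU, hW, hxU, hxW, hUW⟩ := t2_separation hij
  have hmem : ∀ᶠ n in Filter.atTop, PiNat.cylinder x n ⊆ g i ⁻¹' U ∩ g j ⁻¹' W := by
    have hopen : IsOpen (g i ⁻¹' U ∩ g j ⁻¹' W) := (hU.preimage (hg i)).inter (hW.preimage (hg j))
    obtain ⟨_, ⟨y, n, rfl⟩, hxy, hsub⟩ :=
      (PiNat.isTopologicalBasis_cylinders (fun _ : ℕ => ℕ)).exists_subset_of_mem_open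
        (show x ∈ g i ⁻¹' U ∩ g j ⁻¹' W from ⟨hxU, hxW⟩) hopen
    rw [← mem_cylinder_iff_eq.1 hxy] at hsub
    exact Filter.eventually_atTop.2 ⟨n, fun m hm => (cylinder_anti x hm).trans hsub⟩
  obtain ⟨n, hn⟩ := hmem.exists
  have hne : i ≠ j := fun h => hij (h ▸ rfl)
  refine hx n ⟨fun k => if k = i then U else if k = j then W else univ, fun k => ?_,
    fun k => ?_, ?_⟩
  · rw [image_subset_iff]
    intro z hz
    by_cases hki : k = i
    · subst hki; simpa using (hn hz).1
    · by_cases hkj : k = j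
      · subst hkj; simpa [hki] using (hn hz).2
      · simp [hki, hkj]
  · dsimp only
    split_ifs
    exacts [hU.measurableSet, hW.measurableSet, MeasurableSet.univ]
  · refine eq_empty_of_forall_notMem fun p hp => ?_
    rw [mem_iInter] at hp
    have h1 := hp i
    have h2 := hp j
    simp only [if_true, if_neg hne.symm] at h1 h2
    exact disjoint_left.1 hUW h1 h2

/-- **Novikov's separation theorem**: a sequence of analytic sets with empty intersection has Borel
supersets with empty intersection. -/
theorem novikovSeparated_of_analyticSet {X : Type*} [TopologicalSpace X] [T2Space X]
    [MeasurableSpace X] [OpensMeasurableSpace X] {A : ℕ → Set X} (hA : ∀ i, AnalyticSet (A i))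
    (h : ⋂ i, A i = ∅) : NovikovSeparated A := by
  by_cases hne : ∃ i, A i = ∅
  · obtain ⟨i, hi⟩ := hne
    refine ⟨fun k => if k = i then ∅ else univ, fun k => ?_, fun k => ?_, ?_⟩
    · by_cases hk : k = i
      · simp [hk, hi]
      · simp [hk]
    · dsimp only
      split_ifs <;> simp
    · refine eq_empty_of_forall_notMem fun p hp => ?_
      simpa using mem_iInter.1 hp i
  · push Not at hne
    have : ∀ i, ∃ f : (ℕ → ℕ) → X, Continuous f ∧ range f = A i := fun i => by
      have := hA i
      rw [AnalyticSet] at this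
      exact this.resolve_left (hne i).ne_empty
    choose f hf hfA using this
    obtain rfl : (fun i => range (f i)) = A := funext hfA
    exact novikovSeparated_range hf h

/-! ### Projections of Borel sets with small sections -/

/-- A Borel set with open sections is a countable union of Borel rectangles with basic open
sides. -/
theorem exists_iUnion_prod_of_isOpen_sections {X K : Type*} [TopologicalSpace X] [PolishSpace X]
    [MeasurableSpace X] [BorelSpace X] [TopologicalSpace K] [PolishSpace K] [MeasurableSpace K]
    [BorelSpace K] {A : Set (X × K)} (hA : MeasurableSet A) (U : ℕ → Set K)
    (hU : IsTopologicalBasis (range U)) (ho : ∀ x, IsOpen {y | (x, y) ∈ A}) :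
    ∃ B : ℕ → Set X, (∀ n, MeasurableSet (B n)) ∧ A = ⋃ n, B n ×ˢ U n := by
  have hUo : ∀ n, IsOpen (U n) := fun n => hU.isOpen (mem_range_self n)
  -- `Zc n` consists of the `x` whose section fails to contain `U n`, and `S n` of the points of `A`
  -- for which `U n` is no witness of openness.
  let Zc : ℕ → Set X := fun n => Prod.fst '' (Aᶜ ∩ Prod.snd ⁻¹' U n)
  have hZc : ∀ n, AnalyticSet (Zc n) := fun n =>
    (hA.compl.inter ((hUo n).measurableSet.preimage measurable_snd)).analyticSet_image
      measurable_fst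
  let S : ℕ → Set (X × K) := fun n => A ∩ (Prod.fst ⁻¹' Zc n ∪ Prod.snd ⁻¹' (U n)ᶜ)
  have hS : ∀ n, AnalyticSet (S n) := fun n => by
    have h1 : AnalyticSet (Prod.fst ⁻¹' Zc n : Set (X × K)) := (hZc n).preimage continuous_fst
    have h2 : AnalyticSet (Prod.snd ⁻¹' (U n)ᶜ : Set (X × K)) :=
      ((hUo n).measurableSet.compl.preimage measurable_snd).analyticSet
    have h3 : AnalyticSet (Prod.fst ⁻¹' Zc n ∪ Prod.snd ⁻¹' (U n)ᶜ : Set (X × K)) := by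
      rw [union_eq_iUnion]
      exact AnalyticSet.iUnion fun b => by cases b <;> assumption
    have h4 : S n = ⋂ b : Bool, cond b A (Prod.fst ⁻¹' Zc n ∪ Prod.snd ⁻¹' (U n)ᶜ) :=
      inter_eq_iInter
    rw [h4]
    exact AnalyticSet.iInter fun b => by
      cases b
      · exact h3
      · exact hA.analyticSet
  have hemp : ⋂ n, S n = ∅ := by
    refine eq_empty_of_forall_notMem fun p hp => ?_
    rw [mem_iInter] at hp
    obtain ⟨_, ⟨n, rfl⟩, hpn, hsub⟩ :=
      hU.exists_subset_of_mem_open (show p.2 ∈ {y | (p.1, y) ∈ A} from (hp 0).1) (ho p.1)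
    rcases (hp n).2 with ⟨q, ⟨hqA, hqU⟩, hq⟩ | h
    · apply hqA
      have := hsub hqU
      rw [← hq] at this
      exact this
    · exact h hpn
  obtain ⟨Q, hSQ, hQ, hQe⟩ := novikovSeparated_of_analyticSet hS hemp
  -- Over a point of `A` outside `Q n` the section contains `U n`. Lusin separation from `Zc n`
  -- gives a Borel `B n` with `B n ×ˢ U n ⊆ A`.
  have hsep : ∀ n, MeasurablySeparable (Prod.fst '' (A \ Q n)) (Zc n) := fun n => by
    refine ((hA.diff (hQ n)).analyticSet_image measurable_fst).measurablySeparable (hZc n) ?_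
    rw [disjoint_left]
    rintro _ ⟨p, ⟨hpA, hpQ⟩, rfl⟩ hZ
    exact hpQ (hSQ n ⟨hpA, Or.inl hZ⟩)
  choose B hB1 hB2 hB3 using hsep
  refine ⟨B, hB3, Subset.antisymm (fun p hp => ?_) (iUnion_subset ?_)⟩
  · have : ∃ n, p ∉ Q n := by
      by_contra! hall
      have := mem_iInter.2 hall
      rw [hQe] at this
      exact this
    obtain ⟨n, hn⟩ := this
    refine mem_iUnion.2 ⟨n, hB1 n ⟨p, ⟨hp, hn⟩, rfl⟩, ?_⟩
    by_contra hU
    exact hn (hSQ n ⟨hp, Or.inr hU⟩)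
  · rintro n p ⟨hpB, hpU⟩
    by_contra hpA
    exact disjoint_left.1 (hB2 n) ⟨p, ⟨hpA, hpU⟩, rfl⟩ hpB

/-- The projection of a Borel set with closed sections in a compact space is Borel. -/
theorem measurableSet_exists_of_isClosed_sections {X K : Type*} [TopologicalSpace X]
    [PolishSpace X] [MeasurableSpace X] [BorelSpace X] [TopologicalSpace K] [PolishSpace K]
    [CompactSpace K] [MeasurableSpace K] [BorelSpace K] {E : Set (X × K)} (hE : MeasurableSet E)
    (hc : ∀ x, IsClosed {y | (x, y) ∈ E}) : MeasurableSet {x | ∃ y, (x, y) ∈ E} := by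
  obtain ⟨b, hbc, -, hb⟩ := exists_countable_basis K
  by_cases hbne : b.Nonempty
  swap
  · rw [not_nonempty_iff_eq_empty] at hbne
    have : IsEmpty K := by
      have := hb.sUnion_eq
      rw [hbne, sUnion_empty] at this
      exact univ_eq_empty_iff.1 this.symm
    simp
  obtain ⟨U, rfl⟩ := hbc.exists_eq_range hbne
  obtain ⟨B, hB, hEB⟩ := exists_iUnion_prod_of_isOpen_sections hE.compl U hb
    fun x => (hc x).isOpen_compl
  -- A section is empty iff the `U n` with `x ∈ B n` cover `K`; by compactness finitely many
  -- suffice, and there are countably many finite index sets.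
  have hiff : {x | ∃ y, (x, y) ∈ E}ᶜ =
      ⋃ F : {F : Finset ℕ // ⋃ n ∈ F, U n = univ}, ⋂ n ∈ F.1, B n := by
    ext x
    simp only [mem_compl_iff, mem_ofPred_eq, not_exists, mem_iUnion, mem_iInter]
    constructor
    · intro hx
      have hcov : (univ : Set K) ⊆ ⋃ n : {n // x ∈ B n}, U n := by
        intro y _
        have : (x, y) ∈ Eᶜ := hx y
        rw [hEB] at this
        obtain ⟨n, h1, h2⟩ := mem_iUnion.1 this
        exact mem_iUnion.2 ⟨⟨n, h1⟩, h2⟩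
      obtain ⟨t, ht⟩ := isCompact_univ.elim_finite_subcover _
        (fun n : {n // x ∈ B n} => hb.isOpen (mem_range_self n.1)) hcov
      refine ⟨⟨t.map (Function.Embedding.subtype _), ?_⟩, ?_⟩
      · refine eq_univ_of_univ_subset (ht.trans (iUnion₂_subset fun n hn => ?_))
        exact subset_biUnion_of_mem (u := U) (Finset.mem_map_of_mem _ hn)
      · intro n hn
        obtain ⟨m, -, rfl⟩ := Finset.mem_map.1 hn
        exact m.2
    · rintro ⟨F, hF⟩ y hy
      have : y ∈ ⋃ n ∈ F.1, U n := by rw [F.2]; exact mem_univ y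
      simp only [mem_iUnion] at this
      obtain ⟨n, hnF, hyn⟩ := this
      have : (x, y) ∈ Eᶜ := by
        rw [hEB]
        exact mem_iUnion.2 ⟨n, hF n hnF, hyn⟩
      exact this hy
  rw [← MeasurableSet.compl_iff, hiff]
  exact MeasurableSet.iUnion fun F => Finset.measurableSet_biInter _ fun n _ => hB n

/-- The projection of a Borel set with finite sections is Borel. -/
theorem measurableSet_exists_of_finite {X Y : Type*} [MeasurableSpace X] [StandardBorelSpace X]
    [MeasurableSpace Y] [StandardBorelSpace Y] {q : X → Y → Prop}
    (hq : MeasurableSet {p : X × Y | q p.1 p.2}) (hf : ∀ x, {y | q x y}.Finite) :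
    MeasurableSet {x | ∃ y, q x y} := by
  let := upgradeStandardBorel X
  have : PolishSpace (ℕ → Bool) := {}
  -- A Borel injection moves `Y` into a compact space; it preserves Borelness of the set, and finite
  -- sections become closed.
  let φ : Y → ℕ → Bool := MeasurableSpace.mapNatBool Y
  have hφ : Measurable φ := MeasurableSpace.measurable_mapNatBool Y
  have hφi : Function.Injective φ := MeasurableSpace.injective_mapNatBool Y
  let ψ : X × Y → X × (ℕ → Bool) := Prod.map id φ
  have hψi : Function.Injective ψ := Function.injective_id.prodMap hφi
  have hψ : Measurable ψ := measurable_id.prodMap hφ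
  have hE : MeasurableSet (ψ '' {p : X × Y | q p.1 p.2}) :=
    hq.image_of_measurable_injOn hψ hψi.injOn
  have hmain := measurableSet_exists_of_isClosed_sections hE fun x => by
    refine Set.Finite.isClosed (((hf x).image φ).subset ?_)
    rintro z ⟨⟨x', y⟩, hxy, h⟩
    obtain ⟨rfl, rfl⟩ := Prod.mk.inj h
    exact ⟨y, hxy, rfl⟩
  convert hmain using 1
  ext x
  constructor
  · rintro ⟨y, hy⟩
    exact ⟨φ y, ⟨x, y⟩, hy, rfl⟩
  · rintro ⟨z, ⟨x', y⟩, hxy, h⟩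
    obtain ⟨rfl, -⟩ := Prod.mk.inj h
    exact ⟨y, hxy⟩

/-! ### Balls in locally finite graphs -/

section Ball

variable {V : Type u} {G : SimpleGraph V} {m n : ℕ} {x y z : V}

theorem mem_ball_comm : y ∈ ball G n x ↔ x ∈ ball G n y := by
  simp only [ball, Set.mem_ofPred_eq, SimpleGraph.edist_comm]

theorem ball_mono (h : m ≤ n) : ball G m x ⊆ ball G n x := fun _ hy =>
  le_trans (b := (m : ℕ∞)) hy (by exact_mod_cast h)

theorem mem_ball_trans (hy : y ∈ ball G m x) (hz : z ∈ ball G n y) : z ∈ ball G (m + n) x := by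
  have h := SimpleGraph.edist_triangle (G := G) (u := x) (v := y) (w := z)
  refine h.trans ?_
  push_cast
  exact add_le_add hy hz

theorem mem_ball_of_add_le {k : ℕ} (h : m + n ≤ k) (hy : y ∈ ball G m x) (hz : z ∈ ball G n y) :
    z ∈ ball G k x :=
  ball_mono h (mem_ball_trans hy hz)

theorem reachable_of_mem_ball (hy : y ∈ ball G n x) : G.Reachable x y :=
  SimpleGraph.reachable_of_edist_ne_top fun h => by
    simp only [ball, Set.mem_ofPred_eq, h] at hy
    simp at hy

theorem mem_ball_zero : y ∈ ball G 0 x ↔ x = y := by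
  simp only [ball, Set.mem_ofPred_eq, Nat.cast_zero, nonpos_iff_eq_zero,
    SimpleGraph.edist_eq_zero_iff]

theorem mem_ball_succ : y ∈ ball G (n + 1) x ↔ ∃ z ∈ ball G n x, z = y ∨ G.Adj z y := by
  constructor
  · intro hy
    obtain ⟨p, hp⟩ := (reachable_of_mem_ball hy).exists_walk_length_eq_edist
    have hlen : p.length ≤ n + 1 := by
      have : (p.length : ℕ∞) ≤ ((n + 1 : ℕ) : ℕ∞) := hp ▸ hy
      exact_mod_cast this
    rcases Nat.lt_or_ge n p.length with h | h
    · refine ⟨p.penultimate, ?_, Or.inr (p.adj_penultimate ?_)⟩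
      · refine (SimpleGraph.edist_le p.dropLast).trans ?_
        have : p.dropLast.length ≤ n := by
          rw [SimpleGraph.Walk.length_dropLast]; omega
        exact_mod_cast this
      · rw [← SimpleGraph.Walk.length_eq_zero_iff]; omega
    · refine ⟨y, ?_, Or.inl rfl⟩
      rw [ball, Set.mem_ofPred_eq, ← hp]
      exact_mod_cast h
  · rintro ⟨z, hz, rfl | h⟩
    · exact ball_mono n.le_succ hz
    · refine mem_ball_trans hz ?_
      exact (SimpleGraph.edist_eq_one_iff_adj.2 h).le

theorem finite_ball (hfin : ∀ x : V, (G.neighborSet x).Finite) (n : ℕ) (x : V) :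
    (ball G n x).Finite := by
  induction n with
  | zero => exact (Set.finite_singleton x).subset fun y hy => (mem_ball_zero.1 hy).symm
  | succ n ih =>
    refine (ih.biUnion fun z _ => (hfin z).insert z).subset fun y hy => ?_
    obtain ⟨z, hz, h⟩ := mem_ball_succ.1 hy
    refine Set.mem_biUnion hz ?_
    rcases h with rfl | h
    · exact Set.mem_insert _ _
    · exact Set.mem_insert_of_mem _ h

/-- A connected set with at most `n` vertices is contained in a ball around each of its points. -/
theorem subset_ball_of_preconnected {R : Set V} (hR : (G.induce R).Preconnected)
    (hcard : R.encard ≤ (n : ℕ∞)) (hx : x ∈ R) : R ⊆ ball G n x := by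
  intro y hy
  have hRf : R.Finite := Set.finite_of_encard_le_coe hcard
  have := hRf.fintype
  classical
  obtain ⟨p, hp⟩ := (hR ⟨x, hx⟩ ⟨y, hy⟩).exists_isPath
  have hlt := hp.length_lt
  have hle : Fintype.card R ≤ n := by
    rw [← Nat.card_eq_fintype_card, Nat.card_coe_set_eq]
    rw [← Set.Finite.cast_ncard_eq hRf] at hcard
    exact_mod_cast hcard
  have h := SimpleGraph.edist_le (p.map (SimpleGraph.Embedding.induce R).toHom)
  refine h.trans ?_
  rw [SimpleGraph.Walk.length_map]
  exact_mod_cast (hlt.le.trans hle)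

end Ball

/-! ### Borel quantification over balls and a distance colouring -/

section Measurability

variable {V : Type u} [MeasurableSpace V] [StandardBorelSpace V] {G : SimpleGraph V}

theorem measurableSet_eq_of_measurable {Z : Type*} [MeasurableSpace Z] {f g : Z → V}
    (hf : Measurable f) (hg : Measurable g) : MeasurableSet {z | f z = g z} := by
  let := upgradeStandardBorel V
  exact measurableSet_eq_fun hf hg

theorem measurableSet_mem_ball (hG : IsBorelGraph G)
    (hfin : ∀ x : V, (G.neighborSet x).Finite) (n : ℕ) :
    MeasurableSet {p : V × V | p.2 ∈ ball G n p.1} := by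
  induction n with
  | zero =>
    simp only [mem_ball_zero]
    exact measurableSet_eq_of_measurable measurable_fst measurable_snd
  | succ n ih =>
    simp only [mem_ball_succ]
    refine measurableSet_exists_of_finite
      (q := fun (p : V × V) z => z ∈ ball G n p.1 ∧ (z = p.2 ∨ G.Adj z p.2)) ?_ fun p =>
      (finite_ball hfin n p.1).subset fun z hz => hz.1
    refine MeasurableSet.inter ?_ (MeasurableSet.union ?_ ?_)
    · exact ih.preimage (f := fun q : (V × V) × V => (q.1.1, q.2)) (by fun_prop)
    · exact measurableSet_eq_of_measurable (by fun_prop) (by fun_prop)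
    · exact hG.preimage (f := fun q : (V × V) × V => (q.2, q.1.2)) (by fun_prop)

theorem measurableSet_exists_mem_ball (hG : IsBorelGraph G)
    (hfin : ∀ x : V, (G.neighborSet x).Finite) (n : ℕ) {Z : Type*} [MeasurableSpace Z]
    [StandardBorelSpace Z] {g : Z → V} (hg : Measurable g) {q : Z → V → Prop}
    (hq : MeasurableSet {p : Z × V | q p.1 p.2}) :
    MeasurableSet {z | ∃ y ∈ ball G n (g z), q z y} := by
  refine measurableSet_exists_of_finite (q := fun z y => y ∈ ball G n (g z) ∧ q z y) ?_ fun z =>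
    (finite_ball hfin n (g z)).subset fun y hy => hy.1
  exact ((measurableSet_mem_ball hG hfin n).preimage
    (f := fun p : Z × V => (g p.1, p.2)) (by fun_prop)).inter hq

theorem measurableSet_forall_mem_ball (hG : IsBorelGraph G)
    (hfin : ∀ x : V, (G.neighborSet x).Finite) (n : ℕ) {Z : Type*} [MeasurableSpace Z]
    [StandardBorelSpace Z] {g : Z → V} (hg : Measurable g) {q : Z → V → Prop}
    (hq : MeasurableSet {p : Z × V | q p.1 p.2}) :
    MeasurableSet {z | ∀ y ∈ ball G n (g z), q z y} := by
  have h := (measurableSet_exists_mem_ball hG hfin n hg (q := fun z y => ¬ q z y) hq.compl).compl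
  convert h using 1
  ext z
  simp

/-- The preimage of `B` is the projection of the part of the graph over `B`, whose sections have at
most one point. -/
theorem measurable_of_measurableSet_graph {X : Type*} [MeasurableSpace X] [StandardBorelSpace X]
    {f : X → V} (hf : MeasurableSet {p : X × V | f p.1 = p.2}) : Measurable f := by
  intro B hB
  have h := measurableSet_exists_of_finite (q := fun x y => f x = y ∧ y ∈ B)
    (hf.inter (hB.preimage measurable_snd)) fun x =>
      (Set.finite_singleton (f x)).subset fun y hy => hy.1.symm
  convert h using 1
  ext x
  simp

/-- A locally finite Borel graph has a Borel colouring with countably many colours in which any two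
distinct vertices at distance at most `n` have different colours. -/
theorem exists_measurable_coloring (hG : IsBorelGraph G)
    (hfin : ∀ x : V, (G.neighborSet x).Finite) (n : ℕ) :
    ∃ c : V → ℕ, Measurable c ∧ ∀ x, ∀ y ∈ ball G n x, c x = c y → x = y := by
  let := upgradeStandardBorel V
  rcases isEmpty_or_nonempty V with hV | hV
  · exact ⟨fun _ => 0, measurable_const, fun x => hV.elim x⟩
  obtain ⟨U, hU⟩ : ∃ U : ℕ → Set V, TopologicalSpace.IsTopologicalBasis (Set.range U) := by
    obtain ⟨b, hbc, -, hb⟩ := TopologicalSpace.exists_countable_basis V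
    have hne : b.Nonempty := by
      by_contra hne
      have := hb.sUnion_eq
      rw [Set.not_nonempty_iff_eq_empty.1 hne, Set.sUnion_empty] at this
      exact Set.univ_nonempty.ne_empty this.symm
    obtain ⟨U, rfl⟩ := hbc.exists_eq_range hne
    exact ⟨U, hb⟩
  have hUm : ∀ k, MeasurableSet (U k) := fun k => (hU.isOpen (Set.mem_range_self k)).measurableSet
  -- The colour of `x` is the first index of a basic open set isolating `x` within its ball.
  let good : V → ℕ → Prop := fun x k => x ∈ U k ∧ ∀ y ∈ ball G n x, y ∈ U k → x = y
  have hex : ∀ x, ∃ k, good x k := by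
    intro x
    have hfinite : (ball G n x \ {x}).Finite := (finite_ball hfin n x).sdiff
    obtain ⟨_, ⟨k, rfl⟩, hxk, hsub⟩ := hU.exists_subset_of_mem_open
      (show x ∈ (ball G n x \ {x})ᶜ by simp) hfinite.isClosed.isOpen_compl
    refine ⟨k, hxk, fun y hy hyk => ?_⟩
    by_contra hne
    exact hsub hyk ⟨hy, fun h => hne h.symm⟩
  classical
  refine ⟨fun x => Nat.find (hex x), measurable_find hex fun k => ?_, fun x y hy hxy => ?_⟩
  · refine (hUm k).inter (measurableSet_forall_mem_ball hG hfin n measurable_id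
      (q := fun x y => y ∈ U k → x = y) ?_)
    have h : {p : V × V | p.2 ∈ U k → p.1 = p.2} = (Prod.snd ⁻¹' U k)ᶜ ∪ {p | p.1 = p.2} := by
      ext p
      simp [imp_iff_not_or]
    rw [h]
    exact ((hUm k).preimage measurable_snd).compl.union
      (measurableSet_eq_of_measurable measurable_fst measurable_snd)
  · have h1 := Nat.find_spec (hex x)
    have h2 := Nat.find_spec (hex y)
    dsimp only at hxy
    rw [← hxy] at h2
    exact h1.2 y hy h2.1

end Measurability

/-! ### Local rules compute Borel functions -/

section LocalRule

variable {V : Type u} {G : SimpleGraph V}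

theorem LocalRule.eval_congr {Λ : Type v} {β : Type w} (R : LocalRule.{u, v, w} Λ β)
    {c c' : V → Λ} {x : V} (h : ∀ y ∈ ball G R.radius x, c y = c' y) :
    R.eval G c x = R.eval G c' x := by
  unfold LocalRule.eval ballType rootedBall
  congr 3
  funext y
  exact h y y.2

theorem LCL.mem_satSet_congr (P : LCL.{u}) {ℓ a a' : V → ℕ} {x : V} {n : ℕ} (hn : P.radius ≤ n)
    (h : ∀ y ∈ ball G n x, a y = a' y) : x ∈ P.satSet G ℓ a ↔ x ∈ P.satSet G ℓ a' := by
  unfold LCL.satSet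
  simp only [Set.mem_ofPred_eq]
  rw [LocalRule.eval_congr P (c' := fun y => (ℓ y, a' y)) fun y hy => by
    rw [h y (ball_mono hn hy)]]

/-- A finite rooted labelled graph on an initial segment of the natural numbers. -/
abbrev Pattern (Λ : Type v) : Type v :=
  Σ k : ℕ, Fin k × (Fin k → Fin k → Prop) × (Fin k → Λ)

/-- The enumeration `e` identifies the pattern `p` with the labelled `n`-ball around `x`. -/
def Pattern.Realizes {Λ : Type v} (G : SimpleGraph V) (c : V → Λ) (n : ℕ) (p : Pattern Λ)
    (x : V) (e : Fin p.1 → V) : Prop :=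
  (∀ i j, e i = e j → i = j) ∧ e p.2.1 = x ∧ (∀ y ∈ ball G n x, ∃ i, e i = y) ∧
    (∀ i, e i ∈ ball G n x) ∧ (∀ i j, G.Adj (e i) (e j) ↔ p.2.2.1 i j) ∧
    ∀ i, c (e i) = p.2.2.2 i

theorem Pattern.exists_realizes {Λ : Type v} (hfin : ∀ x : V, (G.neighborSet x).Finite)
    (c : V → Λ) (n : ℕ) (x : V) : ∃ (p : Pattern Λ) (e : Fin p.1 → V), p.Realizes G c n x e := by
  have := (finite_ball hfin n x).to_subtype
  let φ := Finite.equivFin (ball G n x)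
  refine ⟨⟨Nat.card (ball G n x), φ ⟨x, mem_ball_self G n x⟩,
    fun i j => G.Adj (φ.symm i) (φ.symm j), fun i => c (φ.symm i)⟩, fun i => φ.symm i, ?_, ?_, ?_,
    ?_, ?_, ?_⟩
  · intro i j h
    exact φ.symm.injective (Subtype.ext h)
  · exact congrArg Subtype.val (φ.symm_apply_apply _)
  · intro y hy
    exact ⟨φ ⟨y, hy⟩, congrArg Subtype.val (φ.symm_apply_apply _)⟩
  · exact fun i => (φ.symm i).2
  · exact fun i j => Iff.rfl
  · exact fun i => rfl

theorem Pattern.Realizes.ballType_eq {Λ : Type v} {c : V → Λ} {n : ℕ} {p : Pattern Λ} {x x' : V}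
    {e e' : Fin p.1 → V} (h : p.Realizes G c n x e) (h' : p.Realizes G c n x' e') :
    ballType G c n x = ballType G c n x' := by
  obtain ⟨h1, h2, h3, h4, h5, h6⟩ := h
  obtain ⟨h1', h2', h3', h4', h5', h6'⟩ := h'
  let φ : Fin p.1 ≃ ball G n x := Equiv.ofBijective (fun i => ⟨e i, h4 i⟩)
    ⟨fun i j hij => h1 i j (congrArg Subtype.val hij), fun y => by
      obtain ⟨i, hi⟩ := h3 y y.2
      exact ⟨i, Subtype.ext hi⟩⟩
  let φ' : Fin p.1 ≃ ball G n x' := Equiv.ofBijective (fun i => ⟨e' i, h4' i⟩)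
    ⟨fun i j hij => h1' i j (congrArg Subtype.val hij), fun y => by
      obtain ⟨i, hi⟩ := h3' y y.2
      exact ⟨i, Subtype.ext hi⟩⟩
  have hφ : ∀ i, (φ i : V) = e i := fun _ => rfl
  have hφ' : ∀ i, (φ' i : V) = e' i := fun _ => rfl
  refine Quotient.sound ⟨⟨φ.symm.trans φ', ?_⟩, ?_, ?_⟩
  · intro y z
    obtain ⟨i, rfl⟩ := φ.surjective y
    obtain ⟨j, rfl⟩ := φ.surjective z
    change G.Adj (φ' (φ.symm (φ i))) (φ' (φ.symm (φ j))) ↔ G.Adj (φ i) (φ j)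
    rw [Equiv.symm_apply_apply, Equiv.symm_apply_apply, hφ, hφ, hφ', hφ', h5, h5']
  · intro y
    obtain ⟨i, rfl⟩ := φ.surjective y
    change c (φ' (φ.symm (φ i))) = c (φ i)
    rw [Equiv.symm_apply_apply, hφ, hφ', h6, h6']
  · change φ' (φ.symm ⟨x, _⟩) = ⟨x', _⟩
    have : (⟨x, mem_ball_self G n x⟩ : ball G n x) = φ p.2.1 := Subtype.ext h2.symm
    rw [this, Equiv.symm_apply_apply]
    exact Subtype.ext h2'

variable [MeasurableSpace V] [StandardBorelSpace V]

/-- An enumeration takes its values in a finite ball, so only finitely many candidates lie over each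
vertex. -/
theorem Pattern.measurableSet_exists_realizes {Λ : Type v} [MeasurableSpace Λ]
    [MeasurableSingletonClass Λ] (hG : IsBorelGraph G)
    (hfin : ∀ x : V, (G.neighborSet x).Finite) {c : V → Λ} (hc : Measurable c) (n : ℕ)
    (p : Pattern Λ) : MeasurableSet {x | ∃ e, p.Realizes G c n x e} := by
  refine measurableSet_exists_of_finite (q := fun x e => p.Realizes G c n x e) ?_ fun x =>
    (Set.Finite.pi' fun _ => finite_ball hfin n x).subset fun e he => he.2.2.2.1
  have hcoord : ∀ i, Measurable fun q : V × (Fin p.1 → V) => q.2 i := fun i => by fun_prop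
  refine MeasurableSet.inter ?_ (MeasurableSet.inter ?_ (MeasurableSet.inter ?_
    (MeasurableSet.inter ?_ (MeasurableSet.inter ?_ ?_))))
  · refine measurableSet_setOfPred.2 (Measurable.forall fun i => Measurable.forall fun j => ?_)
    exact (measurableSet_setOfPred.1 (measurableSet_eq_of_measurable (hcoord i) (hcoord j))).imp
      measurable_const
  · exact measurableSet_eq_of_measurable (hcoord _) measurable_fst
  · refine measurableSet_forall_mem_ball hG hfin n measurable_fst
      (q := fun (q : V × (Fin p.1 → V)) y => ∃ i, q.2 i = y) ?_
    refine measurableSet_setOfPred.2 (Measurable.exists fun i => measurableSet_setOfPred.1 ?_)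
    exact measurableSet_eq_of_measurable (by fun_prop) (by fun_prop)
  · refine measurableSet_setOfPred.2 (Measurable.forall fun i => measurableSet_setOfPred.1 ?_)
    exact (measurableSet_mem_ball hG hfin n).preimage (measurable_fst.prodMk (hcoord i))
  · refine measurableSet_setOfPred.2 (Measurable.forall fun i => Measurable.forall fun j => ?_)
    exact (measurableSet_setOfPred.1 (hG.preimage ((hcoord i).prodMk (hcoord j)))).iff
      measurable_const
  · refine measurableSet_setOfPred.2 (Measurable.forall fun i => measurableSet_setOfPred.1 ?_)
    exact (measurableSet_singleton (p.2.2.2 i)).preimage (hc.comp (hcoord i))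

/-- On a locally finite Borel graph, a local rule computes a Borel function. -/
theorem LocalRule.measurableSet_eval_eq {Λ : Type v} {β : Type w} [Countable Λ]
    [MeasurableSpace Λ] [MeasurableSingletonClass Λ] (R : LocalRule.{u, v, w} Λ β)
    (hG : IsBorelGraph G) (hfin : ∀ x : V, (G.neighborSet x).Finite) {c : V → Λ}
    (hc : Measurable c) (b : β) : MeasurableSet {x | R.eval G c x = b} := by
  -- The output depends only on the pattern realized, and over a countable label set there are
  -- countably many patterns.
  have h : {x | R.eval G c x = b} =
      ⋃ p : {p : Pattern Λ // ∃ x e, p.Realizes G c R.radius x e ∧ R.eval G c x = b},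
        {x | ∃ e, p.1.Realizes G c R.radius x e} := by
    ext x
    rw [Set.mem_iUnion]
    constructor
    · intro hx
      obtain ⟨p, e, he⟩ := Pattern.exists_realizes hfin c R.radius x
      exact ⟨⟨p, x, e, he, hx⟩, e, he⟩
    · rintro ⟨⟨p, x', e', he', hx'⟩, e, he⟩
      refine Eq.trans ?_ hx'
      exact congrArg R.out (he.ballType_eq he')
  rw [h]
  exact MeasurableSet.iUnion fun p => Pattern.measurableSet_exists_realizes hG hfin hc _ p.1

theorem LCL.measurableSet_satSet (P : LCL.{u}) (hG : IsBorelGraph G)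
    (hfin : ∀ x : V, (G.neighborSet x).Finite) {ℓ a : V → ℕ} (hℓ : Measurable ℓ)
    (ha : Measurable a) : MeasurableSet (P.satSet G ℓ a) :=
  LocalRule.measurableSet_eval_eq P hG hfin (hℓ.prodMk ha) true

end LocalRule

/-! ### One round of simultaneous rewriting -/

/-- An instruction `(k, κ, v)` for rewriting an assignment near the vertices of colour `k`:
the vertices whose colour is in the range of `κ` receive the value that `v` gives to their
colour. -/
abbrev Instruction (r : ℕ) : Type :=
  ℕ × (Fin r → ℕ) × (ℕ →₀ ℕ)

section Step

variable {V : Type u}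

open Classical in
/-- The assignment obtained by following an instruction around every vertex of its colour. -/
noncomputable def rewrite (G : SimpleGraph V) (c : V → ℕ) {r : ℕ} (I : Instruction r)
    (a : V → ℕ) : V → ℕ :=
  fun y => if (∃ x ∈ ball G r y, c x = I.1) ∧ ∃ j, I.2.1 j = c y then I.2.2 (c y) else a y

/-- Following the instruction around `x` is an augmentation, as far as the `(r + T)`-ball around
`x` can tell. -/
def IsProgress (C P : LCL.{u}) (G : SimpleGraph V) (ℓ c : V → ℕ) {r : ℕ} (T : ℕ)
    (I : Instruction r) (a : V → ℕ) (x : V) : Prop :=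
  c x = I.1 ∧
    (∀ z ∈ ball G (r + T) x, z ∈ C.satSet G ℓ (rewrite G c I a) ∧
      (z ∈ P.satSet G ℓ a → z ∈ P.satSet G ℓ (rewrite G c I a))) ∧
    ∃ z ∈ ball G (r + T) x, z ∈ P.satSet G ℓ (rewrite G c I a) ∧ z ∉ P.satSet G ℓ a

open Classical in
/-- The assignment obtained by following an instruction around every vertex at which this makes
progress. -/
noncomputable def augmentStep (C P : LCL.{u}) (G : SimpleGraph V) (ℓ c : V → ℕ) {r : ℕ} (T : ℕ)
    (I : Instruction r) (a : V → ℕ) : V → ℕ :=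
  fun y => if ∃ x ∈ ball G r y, IsProgress C P G ℓ c T I a x then rewrite G c I a y else a y

variable {C P : LCL.{u}} {G : SimpleGraph V} {ℓ c : V → ℕ} {r T : ℕ} {I : Instruction r}
  {a : V → ℕ} {x y z : V}

theorem exists_of_rewrite_ne (h : rewrite G c I a y ≠ a y) :
    (∃ x ∈ ball G r y, c x = I.1) ∧ ∃ j, I.2.1 j = c y := by
  by_contra hn
  exact h (if_neg hn)

theorem exists_of_augmentStep_ne (h : augmentStep C P G ℓ c T I a y ≠ a y) :
    (∃ x ∈ ball G r y, IsProgress C P G ℓ c T I a x) ∧ ∃ j, I.2.1 j = c y := by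
  have h1 : ∃ x ∈ ball G r y, IsProgress C P G ℓ c T I a x := by
    by_contra hn
    exact h (if_neg hn)
  refine ⟨h1, (exists_of_rewrite_ne (G := G) (a := a) fun h2 => h ?_).2⟩
  exact (if_pos h1).trans h2

/-- A change at `y` is caused by a vertex of the instruction's colour within `r` of `y`, hence
within `2r + 2T` of `x`; it must be `x`. This is what fixes the distance in the colouring. -/
theorem IsProgress.augmentStep_eq_rewrite
    (hc : ∀ x, ∀ y ∈ ball G (2 * r + 2 * T) x, c x = c y → x = y)
    (hx : IsProgress C P G ℓ c T I a x) (hy : y ∈ ball G (r + 2 * T) x) :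
    augmentStep C P G ℓ c T I a y = rewrite G c I a y := by
  classical
  by_cases h : rewrite G c I a y = a y
  · unfold augmentStep
    rw [h, ite_self]
  · obtain ⟨⟨x', hx', hcx'⟩, -⟩ := exists_of_rewrite_ne h
    obtain rfl : x = x' :=
      hc x x' (mem_ball_of_add_le (by omega) hy hx') (hx.1.trans hcx'.symm)
    exact if_pos ⟨x, hx', hx⟩

theorem IsProgress.mem_satSet_augmentStep
    (hc : ∀ x, ∀ y ∈ ball G (2 * r + 2 * T) x, c x = c y → x = y) {Q : LCL.{u}} (hQ : Q.radius ≤ T)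
    (hx : IsProgress C P G ℓ c T I a x) (hz : z ∈ ball G (r + T) x) :
    z ∈ Q.satSet G ℓ (augmentStep C P G ℓ c T I a) ↔ z ∈ Q.satSet G ℓ (rewrite G c I a) :=
  Q.mem_satSet_congr hQ fun _ hy =>
    hx.augmentStep_eq_rewrite hc (mem_ball_of_add_le (by omega) hz hy)

/-- Changes occur only within `r` of a progress vertex, so beyond `r + T` a rule of radius at most
`T` sees none. -/
theorem mem_satSet_augmentStep_of_forall_not {Q : LCL.{u}} (hQ : Q.radius ≤ T)
    (h : ∀ x, z ∈ ball G (r + T) x → ¬ IsProgress C P G ℓ c T I a x) :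
    z ∈ Q.satSet G ℓ (augmentStep C P G ℓ c T I a) ↔ z ∈ Q.satSet G ℓ a := by
  refine Q.mem_satSet_congr hQ fun y hy => ?_
  by_contra hne
  obtain ⟨⟨x, hx, hpx⟩, -⟩ := exists_of_augmentStep_ne hne
  exact h x (mem_ball_trans (mem_ball_comm.1 hx) (mem_ball_comm.1 hy)) hpx

theorem solves_augmentStep (hc : ∀ x, ∀ y ∈ ball G (2 * r + 2 * T) x, c x = c y → x = y)
    (hC : C.radius ≤ T) (ha : C.Solves G ℓ a) : C.Solves G ℓ (augmentStep C P G ℓ c T I a) := by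
  refine Set.eq_univ_of_forall fun z => ?_
  by_cases h : ∃ x, z ∈ ball G (r + T) x ∧ IsProgress C P G ℓ c T I a x
  · obtain ⟨x, hz, hx⟩ := h
    exact (hx.mem_satSet_augmentStep hc hC hz).2 (hx.2.1 z hz).1
  · push Not at h
    rw [mem_satSet_augmentStep_of_forall_not hC h, show C.satSet G ℓ a = Set.univ from ha]
    trivial

theorem satSet_subset_augmentStep (hc : ∀ x, ∀ y ∈ ball G (2 * r + 2 * T) x, c x = c y → x = y)
    (hP : P.radius ≤ T) : P.satSet G ℓ a ⊆ P.satSet G ℓ (augmentStep C P G ℓ c T I a) := by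
  intro z hza
  by_cases h : ∃ x, z ∈ ball G (r + T) x ∧ IsProgress C P G ℓ c T I a x
  · obtain ⟨x, hz, hx⟩ := h
    exact (hx.mem_satSet_augmentStep hc hP hz).2 ((hx.2.1 z hz).2 hza)
  · push Not at h
    exact (mem_satSet_augmentStep_of_forall_not hP h).2 hza

theorem IsProgress.exists_mem_diff
    (hc : ∀ x, ∀ y ∈ ball G (2 * r + 2 * T) x, c x = c y → x = y) (hP : P.radius ≤ T)
    (hx : IsProgress C P G ℓ c T I a x) :
    ∃ z ∈ ball G (r + T) x, z ∈ P.satSet G ℓ (augmentStep C P G ℓ c T I a) \ P.satSet G ℓ a := by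
  obtain ⟨z, hz, hz1, hz2⟩ := hx.2.2
  exact ⟨z, hz, (hx.mem_satSet_augmentStep hc hP hz).2 hz1, hz2⟩

/-- Every vertex that changes its value in a step is close to a vertex newly satisfying `P`. -/
theorem exists_mem_diff_of_augmentStep_ne
    (hc : ∀ x, ∀ y ∈ ball G (2 * r + 2 * T) x, c x = c y → x = y) (hP : P.radius ≤ T)
    (h : augmentStep C P G ℓ c T I a y ≠ a y) :
    ∃ z ∈ ball G (2 * r + T) y,
      z ∈ P.satSet G ℓ (augmentStep C P G ℓ c T I a) \ P.satSet G ℓ a := by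
  obtain ⟨⟨x, hx, hpx⟩, -⟩ := exists_of_augmentStep_ne h
  obtain ⟨z, hz, hzd⟩ := hpx.exists_mem_diff hc hP
  exact ⟨z, mem_ball_of_add_le (by omega) hx hz, hzd⟩

/-- The vertex of the `j`-th colour of the instruction that belongs to the augmentation performed
near `y`. -/
def IsTarget (C P : LCL.{u}) (G : SimpleGraph V) (ℓ c : V → ℕ) {r : ℕ} (T : ℕ)
    (I : Instruction r) (a : V → ℕ) (j : Fin r) (y z : V) : Prop :=
  ∃ x ∈ ball G (r + T) y, IsProgress C P G ℓ c T I a x ∧ x ∈ ball G r z ∧ I.2.1 j = c z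

/-- Progress vertices share a colour, so `y` has only one within `r + T`; around it, the `j`-th
colour occurs at most once within `r`. This makes the `f j` single-valued. -/
theorem IsTarget.unique (hc : ∀ x, ∀ y ∈ ball G (2 * r + 2 * T) x, c x = c y → x = y) {j : Fin r}
    {z' : V} (hz : IsTarget C P G ℓ c T I a j y z) (hz' : IsTarget C P G ℓ c T I a j y z') :
    z = z' := by
  obtain ⟨x, hxy, hx, hxz, hj⟩ := hz
  obtain ⟨x', hxy', hx', hxz', hj'⟩ := hz'
  obtain rfl : x = x' :=
    hc x x' (mem_ball_of_add_le (by omega) (mem_ball_comm.1 hxy) hxy') (hx.1.trans hx'.1.symm)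
  exact hc z z' (mem_ball_of_add_le (by omega) hxz (mem_ball_comm.1 hxz')) (hj.symm.trans hj')

theorem IsTarget.reachable {j : Fin r} (hz : IsTarget C P G ℓ c T I a j y z) :
    G.Reachable y z := by
  obtain ⟨x, hxy, -, hxz, -⟩ := hz
  exact (reachable_of_mem_ball hxy).trans (reachable_of_mem_ball hxz).symm

theorem exists_isTarget_of_augmentStep_ne
    (hc : ∀ x, ∀ y ∈ ball G (2 * r + 2 * T) x, c x = c y → x = y) (hP : P.radius ≤ T)
    (h : augmentStep C P G ℓ c T I a z ≠ a z) :
    ∃ j y, y ∈ P.satSet G ℓ (augmentStep C P G ℓ c T I a) \ P.satSet G ℓ a ∧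
      IsTarget C P G ℓ c T I a j y z := by
  obtain ⟨⟨x, hx, hpx⟩, j, hj⟩ := exists_of_augmentStep_ne h
  obtain ⟨y, hy, hyd⟩ := hpx.exists_mem_diff hc hP
  exact ⟨j, y, hyd, x, mem_ball_comm.1 hy, hpx, hx, hj⟩

/-- Every augmentation is performed by some instruction, on every assignment that agrees with the
given one near the vertices that change. -/
theorem IsAugmentation.exists_instruction
    (hc : ∀ x, ∀ y ∈ ball G (2 * r + 2 * T) x, c x = c y → x = y)
    (hC : C.radius ≤ T) (hP : P.radius ≤ T) {a' : V → ℕ} (h : IsAugmentation C P G ℓ r a a') :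
    ∃ (I : Instruction r) (x : V), ∀ b : V → ℕ, (∀ w ∈ ball G (r + 2 * T) x, b w = a w) →
      IsProgress C P G ℓ c T I b x := by
  classical
  obtain ⟨R, g, hconn, hcard, rfl, hsol, hsub, hnsub⟩ := h
  obtain ⟨y, hy', hy⟩ := Set.not_subset.1 hnsub
  have hRf : R.Finite := Set.finite_of_encard_le_coe hcard
  have hRcard : R.ncard ≤ r := by
    rw [← Set.Finite.cast_ncard_eq hRf] at hcard
    exact_mod_cast hcard
  have hout : ∀ w, w ∉ R → replace a R g w = a w := fun w hw => dif_neg hw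
  -- The verdict of `P` at `y` changes, so `R` meets the `T`-ball of `y`; any such point serves as
  -- centre.
  obtain ⟨x, hxy, hxR⟩ : ∃ x ∈ ball G T y, x ∈ R := by
    by_contra! hn
    exact hy ((P.mem_satSet_congr hP fun w hw => hout w fun hwR => hn w hw hwR).1 hy')
  have hRx := subset_ball_of_preconnected hconn hcard hxR
  have hinj : ∀ w ∈ R, ∀ w' ∈ ball G r x, c w = c w' → w = w' := fun w hw w' hw' =>
    hc w w' (mem_ball_of_add_le (by omega) (mem_ball_comm.1 (hRx hw)) hw')
  -- When `R` has fewer than `r` vertices, the list repeats some.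
  obtain ⟨e, he⟩ : ∃ e : Fin r → R, Function.Surjective e := by
    have := hRf.fintype
    have : Nonempty R := ⟨⟨x, hxR⟩⟩
    obtain ⟨i⟩ : Nonempty (R ↪ Fin r) := by
      refine Function.Embedding.nonempty_of_card_le ?_
      rwa [Fintype.card_fin, ← Nat.card_eq_fintype_card, Nat.card_coe_set_eq]
    exact ⟨Function.invFun i, Function.invFun_surjective i.injective⟩
  -- Values can be indexed by colour because `c` is injective on `R`; finite support keeps the set
  -- of instructions countable.
  obtain ⟨v, hv⟩ : ∃ v : ℕ →₀ ℕ, ∀ w : R, v (c w) = g w := by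
    refine ⟨Finsupp.ofSupportFinite
      (fun m => if h : ∃ w : R, c w = m then g h.choose else 0) ?_, fun w => ?_⟩
    · refine (hRf.image c).subset fun m hm => ?_
      by_contra hn
      refine hm (dif_neg ?_)
      rintro ⟨w, rfl⟩
      exact hn ⟨w, w.2, rfl⟩
    · have h : ∃ w' : R, c w' = c w := ⟨w, rfl⟩
      rw [Finsupp.ofSupportFinite_coe, dif_pos h]
      congr 1
      exact Subtype.ext (hinj _ h.choose.2 _ (hRx w.2) h.choose_spec)
  refine ⟨(c x, fun j => c (e j), v), x, fun b hb => ?_⟩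
  have hrew : ∀ w ∈ ball G (r + 2 * T) x,
      rewrite G c (c x, fun j => c (e j), v) b w = replace a R g w := by
    intro w hw
    by_cases hwR : w ∈ R
    · obtain ⟨j, hj⟩ := he ⟨w, hwR⟩
      have h : rewrite G c (c x, fun j => c (e j), v) b w = v (c w) :=
        if_pos ⟨⟨x, mem_ball_comm.1 (hRx hwR), rfl⟩, j, congrArg (fun u : R => c u) hj⟩
      rw [h, hv ⟨w, hwR⟩, replace, dif_pos hwR]
    · rw [hout w hwR, ← hb w hw]
      by_contra hne
      obtain ⟨⟨x', hx', hcx'⟩, j, hj⟩ := exists_of_rewrite_ne hne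
      -- A rewriting this close to `x` is centred at `x`, and a listed colour within `r` of `x`
      -- occurs only in `R`.
      obtain rfl : x = x' := hc x x' (mem_ball_of_add_le (by omega) hw hx') hcx'.symm
      have := hinj _ (e j).2 w (mem_ball_comm.1 hx') hj
      exact hwR (this ▸ (e j).2)
  have hQ : ∀ Q : LCL.{u}, Q.radius ≤ T → ∀ z ∈ ball G (r + T) x,
      (z ∈ Q.satSet G ℓ (rewrite G c (c x, fun j => c (e j), v) b) ↔
        z ∈ Q.satSet G ℓ (replace a R g)) ∧ (z ∈ Q.satSet G ℓ b ↔ z ∈ Q.satSet G ℓ a) :=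
    fun Q hQ z hz =>
      ⟨Q.mem_satSet_congr hQ fun w hw => hrew w (mem_ball_of_add_le (by omega) hz hw),
        Q.mem_satSet_congr hQ fun w hw => hb w (mem_ball_of_add_le (by omega) hz hw)⟩
  have hyx : y ∈ ball G (r + T) x := ball_mono (by omega) (mem_ball_comm.1 hxy)
  refine ⟨rfl, fun z hz => ⟨?_, fun hzb => ?_⟩, y, hyx, ?_, fun hyb => ?_⟩
  · rw [(hQ C hC z hz).1, show C.satSet G ℓ (replace a R g) = Set.univ from hsol]
    trivial
  · exact (hQ P hP z hz).1.2 (hsub ((hQ P hP z hz).2.1 hzb))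
  · exact (hQ P hP y hyx).1.2 hy'
  · exact hy ((hQ P hP y hyx).2.1 hyb)

section Measurability

theorem measurableSet_exists_eq_color [MeasurableSpace V] (hc : Measurable c) (κ : Fin r → ℕ) :
    MeasurableSet {y | ∃ j, κ j = c y} := by
  refine measurableSet_setOfPred.2 (Measurable.exists fun j => measurableSet_setOfPred.1 ?_)
  exact measurableSet_eq_fun measurable_const hc

variable [MeasurableSpace V] [StandardBorelSpace V]

theorem measurable_rewrite (hG : IsBorelGraph G) (hfin : ∀ x : V, (G.neighborSet x).Finite)
    (hc : Measurable c) (ha : Measurable a) : Measurable (rewrite G c I a) := by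
  refine Measurable.ite (MeasurableSet.inter ?_ (measurableSet_exists_eq_color hc _))
    (measurable_from_nat.comp hc) ha
  exact measurableSet_exists_mem_ball hG hfin r measurable_id (q := fun _ x => c x = I.1)
    (measurableSet_eq_fun (hc.comp measurable_snd) measurable_const)

theorem measurableSet_isProgress (hG : IsBorelGraph G) (hfin : ∀ x : V, (G.neighborSet x).Finite)
    (hℓ : Measurable ℓ) (hc : Measurable c) (ha : Measurable a) :
    MeasurableSet {x | IsProgress C P G ℓ c T I a x} := by
  have hrw : Measurable (rewrite G c I a) := measurable_rewrite hG hfin hc ha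
  have hCr := C.measurableSet_satSet hG hfin hℓ hrw
  have hPr := P.measurableSet_satSet hG hfin hℓ hrw
  have hPa := P.measurableSet_satSet hG hfin hℓ ha
  refine MeasurableSet.inter (measurableSet_eq_fun hc measurable_const)
    (MeasurableSet.inter ?_ ?_)
  · refine measurableSet_forall_mem_ball hG hfin (r + T) measurable_id
      (q := fun _ z => z ∈ C.satSet G ℓ (rewrite G c I a) ∧
        (z ∈ P.satSet G ℓ a → z ∈ P.satSet G ℓ (rewrite G c I a))) ?_
    refine (hCr.preimage measurable_snd).inter (measurableSet_setOfPred.2 ?_)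
    exact (measurableSet_setOfPred.1 (hPa.preimage measurable_snd)).imp
      (measurableSet_setOfPred.1 (hPr.preimage measurable_snd))
  · exact measurableSet_exists_mem_ball hG hfin (r + T) measurable_id
      (q := fun _ z => z ∈ P.satSet G ℓ (rewrite G c I a) ∧ z ∉ P.satSet G ℓ a)
      ((hPr.preimage measurable_snd).inter (hPa.preimage measurable_snd).compl)

theorem measurable_augmentStep (hG : IsBorelGraph G) (hfin : ∀ x : V, (G.neighborSet x).Finite)
    (hℓ : Measurable ℓ) (hc : Measurable c) (ha : Measurable a) :
    Measurable (augmentStep C P G ℓ c T I a) := by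
  refine Measurable.ite ?_ (measurable_rewrite hG hfin hc ha) ha
  exact measurableSet_exists_mem_ball hG hfin r measurable_id
    (q := fun _ x => IsProgress C P G ℓ c T I a x)
    ((measurableSet_isProgress hG hfin hℓ hc ha).preimage measurable_snd)

theorem measurableSet_isTarget (hG : IsBorelGraph G) (hfin : ∀ x : V, (G.neighborSet x).Finite)
    (hℓ : Measurable ℓ) (hc : Measurable c) (ha : Measurable a) (j : Fin r) :
    MeasurableSet {p : V × V | IsTarget C P G ℓ c T I a j p.1 p.2} := by
  refine measurableSet_exists_mem_ball hG hfin (r + T) measurable_fst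
    (q := fun (p : V × V) x =>
      IsProgress C P G ℓ c T I a x ∧ x ∈ ball G r p.2 ∧ I.2.1 j = c p.2) ?_
  refine MeasurableSet.inter ?_ (MeasurableSet.inter ?_ ?_)
  · exact (measurableSet_isProgress hG hfin hℓ hc ha).preimage measurable_snd
  · exact (measurableSet_mem_ball hG hfin r).preimage
      (f := fun q : (V × V) × V => (q.1.2, q.2)) (by fun_prop)
  · exact measurableSet_eq_fun measurable_const
      (hc.comp (measurable_snd.comp measurable_fst))

/-- A Borel partial function extends to a Borel function with prescribed default values. -/
theorem exists_measurable_extension {X : Type*} [MeasurableSpace X] [StandardBorelSpace X]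
    {q : X → V → Prop} (hq : MeasurableSet {p : X × V | q p.1 p.2})
    (huniq : ∀ x z z', q x z → q x z' → z = z') {d : X → V} (hd : Measurable d) :
    ∃ f : X → V, Measurable f ∧ (∀ x z, q x z → f x = z) ∧ ∀ x, q x (f x) ∨ f x = d x := by
  classical
  let f : X → V := fun x => if h : ∃ z, q x z then h.choose else d x
  have hf1 : ∀ x z, q x z → f x = z := fun x z hz => by
    have h : ∃ z, q x z := ⟨z, hz⟩
    exact (dif_pos h).trans (huniq x _ _ h.choose_spec hz)
  have hf2 : ∀ x, (¬ ∃ z, q x z) → f x = d x := fun x h => dif_neg h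
  have hdom : MeasurableSet {x | ∃ z, q x z} := measurableSet_exists_of_finite hq fun x =>
    Set.Subsingleton.finite fun z hz z' hz' => huniq x z z' hz hz'
  refine ⟨f, measurable_of_measurableSet_graph ?_, hf1, fun x => ?_⟩
  · have h : {p : X × V | f p.1 = p.2} = {p | q p.1 p.2} ∪
        ({p | d p.1 = p.2} ∩ (Prod.fst ⁻¹' {x | ∃ z, q x z})ᶜ) := by
      ext ⟨x, y⟩
      by_cases hx : ∃ z, q x z
      · obtain ⟨z, hz⟩ := hx
        have hex : ∃ z, q x z := ⟨z, hz⟩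
        simp only [Set.mem_union, Set.mem_inter_iff, Set.mem_compl_iff, Set.mem_preimage,
          Set.mem_ofPred_eq, hex, not_true, and_false, or_false, hf1 x z hz]
        exact ⟨fun h => h ▸ hz, fun h => huniq x z y hz h⟩
      · have hn : ¬ q x y := fun h => hx ⟨y, h⟩
        simp only [Set.mem_union, Set.mem_inter_iff, Set.mem_compl_iff, Set.mem_preimage,
          Set.mem_ofPred_eq, hx, hn, not_false_iff, and_true, false_or, hf2 x hx]
    rw [h]
    exact hq.union ((measurableSet_eq_of_measurable (hd.comp measurable_fst)
      measurable_snd).inter (hdom.preimage measurable_fst).compl)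
  · by_cases h : ∃ z, q x z
    · obtain ⟨z, hz⟩ := h
      exact Or.inl ((hf1 x z hz).symm ▸ hz)
    · exact Or.inr (hf2 x h)

end Measurability

end Step

/-! ### Iterating the instructions -/

section Iteration

variable {V : Type u} {C P : LCL.{u}} {G : SimpleGraph V} {ℓ c : V → ℕ} {r T : ℕ}
  {s : ℕ → Instruction r} {a₀ : V → ℕ} {x y z : V} {m n : ℕ}

/-- The assignments obtained from `a₀` by following a sequence of instructions. -/
noncomputable def augmentSeq (C P : LCL.{u}) (G : SimpleGraph V) (ℓ c : V → ℕ) {r : ℕ} (T : ℕ)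
    (s : ℕ → Instruction r) (a₀ : V → ℕ) : ℕ → V → ℕ
  | 0 => a₀
  | n + 1 => augmentStep C P G ℓ c T (s n) (augmentSeq C P G ℓ c T s a₀ n)

theorem satSet_augmentSeq_mono (hc : ∀ x, ∀ y ∈ ball G (2 * r + 2 * T) x, c x = c y → x = y)
    (hP : P.radius ≤ T) : Monotone fun n => P.satSet G ℓ (augmentSeq C P G ℓ c T s a₀ n) :=
  monotone_nat_of_le_succ fun _ => satSet_subset_augmentStep hc hP

theorem solves_augmentSeq (hc : ∀ x, ∀ y ∈ ball G (2 * r + 2 * T) x, c x = c y → x = y)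
    (hC : C.radius ≤ T) (ha : C.Solves G ℓ a₀) (n : ℕ) :
    C.Solves G ℓ (augmentSeq C P G ℓ c T s a₀ n) := by
  induction n with
  | zero => exact ha
  | succ n ih => exact solves_augmentStep hc hC ih

/-- The vertex `y` starts to satisfy `P` at step `n`. -/
def IsGained (C P : LCL.{u}) (G : SimpleGraph V) (ℓ c : V → ℕ) {r : ℕ} (T : ℕ)
    (s : ℕ → Instruction r) (a₀ : V → ℕ) (n : ℕ) (y : V) : Prop :=
  y ∈ P.satSet G ℓ (augmentSeq C P G ℓ c T s a₀ (n + 1)) \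
    P.satSet G ℓ (augmentSeq C P G ℓ c T s a₀ n)

theorem IsGained.eq (hc : ∀ x, ∀ y ∈ ball G (2 * r + 2 * T) x, c x = c y → x = y)
    (hP : P.radius ≤ T) (hm : IsGained C P G ℓ c T s a₀ m y) (hn : IsGained C P G ℓ c T s a₀ n y) :
    m = n := by
  rcases lt_trichotomy m n with h | h | h
  · exact absurd (satSet_augmentSeq_mono hc hP (Nat.succ_le_of_lt h) hm.1) hn.2
  · exact h
  · exact absurd (satSet_augmentSeq_mono hc hP (Nat.succ_le_of_lt h) hn.1) hm.2

/-- Each change at `x` needs a vertex of the finite ball of radius `2r + T` to be gained at that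
step, and each vertex is gained at most once. -/
theorem eventually_augmentSeq_eq (hc : ∀ x, ∀ y ∈ ball G (2 * r + 2 * T) x, c x = c y → x = y)
    (hfin : ∀ x : V, (G.neighborSet x).Finite) (hP : P.radius ≤ T) (x : V) :
    ∃ k, ∀ᶠ n in Filter.atTop, augmentSeq C P G ℓ c T s a₀ n x = k := by
  have h : ∀ᶠ n in Filter.atTop, ∀ y ∈ ball G (2 * r + T) x, ¬ IsGained C P G ℓ c T s a₀ n y := by
    refine (Filter.eventually_all_finite (finite_ball hfin _ x)).2 fun y _ => ?_
    by_cases hy : ∃ m, IsGained C P G ℓ c T s a₀ m y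
    · obtain ⟨m, hm⟩ := hy
      filter_upwards [Filter.eventually_gt_atTop m] with n hn hgain
      exact hn.ne (hm.eq hc hP hgain)
    · push Not at hy
      exact Filter.Eventually.of_forall hy
  obtain ⟨N, hN⟩ := Filter.eventually_atTop.1 h
  refine ⟨augmentSeq C P G ℓ c T s a₀ N x, Filter.eventually_atTop.2 ⟨N, fun n hn => ?_⟩⟩
  induction n, hn using Nat.le_induction with
  | base => rfl
  | succ n hn ih =>
    rw [← ih]
    by_contra hne
    obtain ⟨y, hy, hgain⟩ := exists_mem_diff_of_augmentStep_ne hc hP hne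
    exact hN n hn y hy hgain

end Iteration

/-- A countable nonempty type is the range of a sequence in which every value recurs. -/
theorem exists_seq_frequently_eq (α : Type*) [Countable α] [Nonempty α] :
    ∃ s : ℕ → α, ∀ i, ∃ᶠ n in Filter.atTop, s n = i := by
  obtain ⟨g, hg⟩ := exists_surjective_nat α
  refine ⟨fun n => g n.unpair.1, fun i => Filter.frequently_atTop.2 fun N => ?_⟩
  obtain ⟨m, rfl⟩ := hg i
  exact ⟨Nat.pair m N, Nat.right_le_pair m N, by simp⟩

end BorelLCL

/-! ### The limit assignment -/

theorem theorem5p17 (C P : BorelLCL.LCL.{u})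
    {V : Type u} [MeasurableSpace V] [StandardBorelSpace V]
    (G : SimpleGraph V) (hG : BorelLCL.IsBorelGraph G)
    (hfin : ∀ x : V, (G.neighborSet x).Finite)
    (ℓ : V → ℕ) (hℓ : Measurable ℓ)
    (a₀ : V → ℕ) (ha₀ : Measurable a₀) (hsol : BorelLCL.LCL.Solves C G ℓ a₀)
    (r : ℕ) (hr : 1 ≤ r) :
    ∃ a : V → ℕ, Measurable a ∧ BorelLCL.LCL.Solves C G ℓ a ∧
      (¬ ∃ a' : V → ℕ, BorelLCL.IsAugmentation C P G ℓ r a a') ∧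
      MeasurableSet (BorelLCL.LCL.satSet P G ℓ a \ BorelLCL.LCL.satSet P G ℓ a₀) ∧
      ∃ f : Fin r →
          ↥(BorelLCL.LCL.satSet P G ℓ a \ BorelLCL.LCL.satSet P G ℓ a₀) → V,
        (∀ j, Measurable (f j)) ∧
        (∀ j y, G.Reachable y.1 (f j y)) ∧
        ∀ x : V, a x ≠ a₀ x → ∃ j y, f j y = x := by
  open BorelLCL in
  let T := max C.radius P.radius
  have hC : C.radius ≤ T := le_max_left _ _
  have hP : P.radius ≤ T := le_max_right _ _
  obtain ⟨c, hcm, hc⟩ := exists_measurable_coloring hG hfin (2 * r + 2 * T)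
  obtain ⟨s, hs⟩ := exists_seq_frequently_eq (Instruction r)
  let A : ℕ → V → ℕ := augmentSeq C P G ℓ c T s a₀
  have hAm : ∀ n, Measurable (A n) := fun n => by
    induction n with
    | zero => exact ha₀
    | succ n ih => exact measurable_augmentStep hG hfin hℓ hcm ih
  have hmono : Monotone fun n => P.satSet G ℓ (A n) := satSet_augmentSeq_mono hc hP
  choose a ha using fun x => eventually_augmentSeq_eq (C := C) (ℓ := ℓ) (s := s) (a₀ := a₀)
    hc hfin hP x
  have haball : ∀ k x, ∀ᶠ n in Filter.atTop, ∀ w ∈ ball G k x, A n w = a w := fun k x =>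
    (Filter.eventually_all_finite (finite_ball hfin k x)).2 fun w _ => ha w
  have hlim : ∀ Q : LCL.{u}, ∀ x,
      ∀ᶠ n in Filter.atTop, (x ∈ Q.satSet G ℓ (A n) ↔ x ∈ Q.satSet G ℓ a) := fun Q x =>
    (haball Q.radius x).mono fun n hn => Q.mem_satSet_congr le_rfl hn
  have hsub : ∀ n, P.satSet G ℓ (A n) ⊆ P.satSet G ℓ a := fun n x hx => by
    obtain ⟨m, hm, hnm⟩ := ((hlim P x).and (Filter.eventually_ge_atTop n)).exists
    exact hm.1 (hmono hnm hx)
  have ham : Measurable a := by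
    refine measurable_of_tendsto_metrizable hAm (tendsto_pi_nhds.2 fun x => ?_)
    exact tendsto_const_nhds.congr' ((ha x).mono fun n hn => hn.symm)
  refine ⟨a, ham, ?_, ?_, ?_, ?_⟩
  · refine Set.eq_univ_of_forall fun x => ?_
    obtain ⟨n, hn⟩ := (hlim C x).exists
    have h : C.satSet G ℓ (A n) = Set.univ := solves_augmentSeq hc hC hsol n
    exact hn.1 (h ▸ Set.mem_univ x)
  · rintro ⟨a', haug⟩
    obtain ⟨I, x, hI⟩ := haug.exists_instruction hc hC hP
    -- The instruction recurs after the values in this finite ball have become final.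
    obtain ⟨n, hn, hball⟩ := ((hs I).and_eventually (haball (r + 2 * T) x)).exists
    have hprog := hI (A n) hball
    rw [← hn] at hprog
    obtain ⟨z, hz, hz1, hz2⟩ := hprog.exists_mem_diff hc hP
    have hza : z ∈ P.satSet G ℓ a := hsub (n + 1) hz1
    -- The `T`-ball of `z` is already final at stage `n`, so `z` satisfies `P` there and cannot be
    -- newly gained.
    refine hz2 ((P.mem_satSet_congr hP fun w hw => ?_).2 hza)
    exact hball w (mem_ball_of_add_le (by omega) hz hw)
  · exact (P.measurableSet_satSet hG hfin hℓ ham).diff (P.measurableSet_satSet hG hfin hℓ ha₀)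
  · let q : Fin r → V → V → Prop := fun j y z =>
      ∃ n, IsGained C P G ℓ c T s a₀ n y ∧ IsTarget C P G ℓ c T (s n) (A n) j y z
    have hq : ∀ j, MeasurableSet {p : V × V | q j p.1 p.2} := fun j => by
      refine measurableSet_setOfPred.2 (Measurable.exists fun n => measurableSet_setOfPred.1 ?_)
      refine MeasurableSet.inter ?_ (measurableSet_isTarget hG hfin hℓ hcm (hAm n) j)
      exact ((P.measurableSet_satSet hG hfin hℓ (hAm (n + 1))).diff
        (P.measurableSet_satSet hG hfin hℓ (hAm n))).preimage measurable_fst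
    have huniq : ∀ j y z z', q j y z → q j y z' → z = z' := by
      rintro j y z z' ⟨n, hn, hz⟩ ⟨n', hn', hz'⟩
      obtain rfl := hn.eq hc hP hn'
      exact hz.unique hc hz'
    -- Where there is no target the default is `y` itself, which stays in its component.
    choose f hfm hf1 hf2 using fun j => exists_measurable_extension (hq j) (huniq j) measurable_id
    refine ⟨fun j y => f j y, fun j => (hfm j).comp measurable_subtype_coe, fun j y => ?_,
      fun x hx => ?_⟩
    · rcases hf2 j y with ⟨n, -, h⟩ | h
      · exact h.reachable
      · dsimp only
        rw [h]
        exact SimpleGraph.Reachable.refl _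
    · obtain ⟨n, hn⟩ : ∃ n, A (n + 1) x ≠ A n x := by
        by_contra! hall
        have h0 : ∀ n, A n x = a₀ x := fun n => by
          induction n with
          | zero => rfl
          | succ n ih => rw [hall, ih]
        obtain ⟨n, hn⟩ := (ha x).exists
        exact hx (hn.symm.trans (h0 n))
      obtain ⟨j, y, hy, htarget⟩ := exists_isTarget_of_augmentStep_ne hc hP hn
      refine ⟨j, ⟨y, hsub (n + 1) hy.1, fun h => hy.2 (hmono n.zero_le h)⟩, ?_⟩
      exact hf1 j y x ⟨n, hy, htarget⟩
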